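/- **Corollary.** Let $M$ be a smooth manifold (finite-dimensional, Hausdorff, second countable, without boundary, not necessarily connected), regarded as a diffeological space with its standard diffeology, whose plots are the smooth maps $U \to M$ in the usual sense. Then $M$ is fibrant, that is, its smooth singular simplicial set $S^D(M)$ is a Kan complex. Here $S^D(M)$ is the simplicial set with $S^D_n(M) = C^\infty(\mathbb{A}^n, M)$, where $\mathbb{A}^n = \{(x_0,\dots,x_n) \in \mathbb{R}^{n+1} : \sum_i x_i = 1\}$ carries the sub-diffeology from $\mathbb{R}^{n+1}$ and a map $f : [m] \to [n]$ in the simplex category acts by precomposition with the affine map $f_* : \mathbb{A}^m \to \mathbb{A}^n$, $(f_* x)_j = \sum_{f(i) = j} x_i$. -/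

import Mathlib

open CategoryTheory Diffeology
open scoped Manifold ContDiff TypeCat

universe u

noncomputable section

/-- The largest diffeology on `A` making `f : A → X` smooth: a map into `A` is a plot iff its
composition with `f` is a plot of `X`. For the inclusion of a subset this is the sub-diffeology. -/
@[reducible]
def DiffeologicalSpace.pullback {A X : Type*} [DiffeologicalSpace X] (f : A → X) :
    DiffeologicalSpace A where
  plots _ := {p | IsPlot (f ∘ p)}
  constant_plots x := isPlot_const (x := f x)
  plot_reparam hp hg := isPlot_reparam (X := X) hp hg
  locality {n p} hp := DiffeologicalSpace.locality (X := X) (n := n) (p := f ∘ p) fun x ↦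
    let ⟨u, hu, hxu, h⟩ := hp x
    ⟨u, hu, hxu, fun hg hg' ↦ h hg hg'⟩

/-- The standard diffeology on a smooth manifold: the plots are the smooth maps in the usual
sense. -/
@[reducible]
def ModelWithCorners.diffeology {E : Type*} [NormedAddCommGroup E] [NormedSpace ℝ E]
    {H : Type*} [TopologicalSpace H] (I : ModelWithCorners ℝ E H)
    (M : Type*) [TopologicalSpace M] [ChartedSpace H M] : DiffeologicalSpace M :=
  .ofCorePlotsOn {
    isPlotOn := fun {n u} _ p ↦ ContMDiffOn 𝓘(ℝ, EuclideanSpace ℝ (Fin n)) I ∞ p u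
    isPlotOn_congr := fun _ _ _ h ↦ contMDiffOn_congr h
    isPlot := fun {n} p ↦ ContMDiff 𝓘(ℝ, EuclideanSpace ℝ (Fin n)) I ∞ p
    isPlotOn_univ := contMDiffOn_univ
    isPlot_const := fun _ ↦ contMDiff_const
    isPlotOn_reparam := fun _ _ _ h hp hf ↦ hp.comp hf.contMDiffOn h
    locality := fun _ _ h x hxu ↦
      let ⟨_, hv, hxv, hv'⟩ := h x hxu
      ((hv' x hxv).contMDiffAt (hv.mem_nhds hxv)).contMDiffWithinAt }

/-- The affine simplex `𝔸ⁿ = {x ∈ ℝⁿ⁺¹ | ∑ xᵢ = 1}` (no sign condition on the coordinates). -/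
def AffineSimplex (n : SimplexCategory) : Type :=
  {x : EuclideanSpace ℝ (Fin (n.len + 1)) // ∑ i, x i = 1}

namespace AffineSimplex

/-- `𝔸ⁿ` carries the sub-diffeology from `ℝⁿ⁺¹`. -/
instance (n : SimplexCategory) : DiffeologicalSpace (AffineSimplex n) :=
  .pullback (fun x : AffineSimplex n ↦ x.1)

/-- The affine map `𝔸ⁿ → 𝔸ᵐ` induced by a monotone map `f : [n] → [m]`; it sends the vertex `eᵢ`
to the vertex `e_{f i}`. -/
def map {n m : SimplexCategory} (f : n ⟶ m) (x : AffineSimplex n) : AffineSimplex m :=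
  ⟨WithLp.toLp 2 fun j ↦ ∑ i, if f i = j then x.1 i else 0, by
    have h := x.2
    simp only
    rw [Finset.sum_comm]
    simpa using h⟩

lemma map_apply {n m : SimplexCategory} (f : n ⟶ m) (x : AffineSimplex n)
    (j : Fin (m.len + 1)) : (map f x).1 j = ∑ i, if f i = j then x.1 i else 0 := rfl

lemma map_id (n : SimplexCategory) : map (𝟙 n) = id := by
  funext x
  apply Subtype.ext
  ext j
  rw [map_apply]
  simp

lemma map_comp {n m k : SimplexCategory} (f : n ⟶ m) (g : m ⟶ k) :
    map (f ≫ g) = map g ∘ map f := by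
  funext x
  apply Subtype.ext
  ext j
  have h (b : Fin (m.len + 1)) : (if g b = j then ∑ i, if f i = b then x.1 i else 0 else 0) =
      ∑ i, if f i = b then (if g (f i) = j then x.1 i else 0) else 0 := by
    split_ifs with hb
    · refine Finset.sum_congr rfl fun i _ ↦ ?_
      split_ifs <;> simp_all
    · refine (Finset.sum_eq_zero fun i _ ↦ ?_).symm
      split_ifs <;> simp_all
  simp only [Function.comp_apply, map_apply, h]
  rw [Finset.sum_comm]
  simp

lemma dSmooth_map {n m : SimplexCategory} (f : n ⟶ m) : DSmooth (map f) := by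
  intro k p hp
  have hp' : ContDiff ℝ ∞ fun y ↦ (p y).1 := hp
  change ContDiff ℝ ∞ fun y ↦ (map f (p y)).1
  rw [contDiff_euclidean] at hp' ⊢
  intro j
  simp only [map_apply]
  refine ContDiff.sum fun i _ ↦ ?_
  split_ifs
  · exact hp' i
  · exact contDiff_const

end AffineSimplex

/-- The smooth singular simplicial set `S^D(X)`: its `n`-simplices are the smooth maps `𝔸ⁿ → X`,
and `f : [n] → [m]` acts by precomposition with the induced map `𝔸ⁿ → 𝔸ᵐ`. -/
def smoothSing (X : Type u) [DiffeologicalSpace X] : SSet.{u} where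
  obj n := {σ : AffineSimplex n.unop → X // DSmooth σ}
  map f := ↾fun σ ↦ ⟨σ.1 ∘ AffineSimplex.map f.unop, σ.2.comp (AffineSimplex.dSmooth_map f.unop)⟩
  map_id n := by
    ext σ x
    simp [AffineSimplex.map_id]
  map_comp f g := by
    ext σ x
    simp [AffineSimplex.map_comp, Function.comp_assoc]

/-- A diffeological space is fibrant if its smooth singular simplicial set is a Kan complex. -/
def DiffeologicalSpace.IsFibrant {X : Type u} (_ : DiffeologicalSpace X) : Prop :=
  SSet.KanComplex (smoothSing X)

end

section SmoothExtension

open Set Topology Filter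

variable {V : Type*} [NormedAddCommGroup V] [NormedSpace ℝ V] [FiniteDimensional ℝ V]
  {E : Type*} [NormedAddCommGroup E] [NormedSpace ℝ E]
  {H : Type*} [TopologicalSpace H] (I : ModelWithCorners ℝ E H)
  {M : Type*} [TopologicalSpace M] [ChartedSpace H M]

/-- `g` is smooth on a neighbourhood of `A`, on which it agrees with `f` at the points of `X`. -/
def IsSmoothExtensionNear (X : Set V) (f : V → M) (A : Set V) (g : V → M) : Prop :=
  ∃ O, IsOpen O ∧ A ⊆ O ∧ ContMDiffOn 𝓘(ℝ, V) I ∞ g O ∧ EqOn g f (O ∩ X)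

/-- Smooth cutoff functions on a finite-dimensional vector space. -/
lemma exists_smooth_cutoff {A O : Set V} (hA : IsClosed A) (hO : IsOpen O) (hAO : A ⊆ O) :
    ∃ ρ : V → ℝ, ContDiff ℝ ∞ ρ ∧ (∀ᶠ x in 𝓝ˢ A, ρ x = 1) ∧ tsupport ρ ⊆ O ∧
      ∀ x, ρ x ∈ Icc (0 : ℝ) 1 := by
  obtain ⟨O', hO', hAO', hO'O⟩ := normal_exists_closure_subset hA hO hAO
  obtain ⟨ρ, h1, h0, h01⟩ := exists_contMDiffMap_one_nhds_of_subset_interior (n := ⊤)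
    𝓘(ℝ, V) hA (hAO'.trans hO'.interior_eq.ge)
  refine ⟨ρ, ρ.contMDiff.contDiff, h1, (closure_mono fun x hx ↦ ?_).trans hO'O, h01⟩
  by_contra h
  exact hx (h0 x h)

variable {I} in
/-- The local step: an extension near a closed set can be modified away from that set so that it
becomes an extension near a given point as well. -/
lemma exists_isSmoothExtensionNear_union_nhds [IsManifold I ∞ M] [BoundarylessManifold I M]
    {X : Set V} (hX : IsClosed X) {f : V → M} {x : V} (hx : x ∈ X)
    (hf : ∃ g, IsSmoothExtensionNear I X f {x} g) :
    ∃ t ∈ 𝓝[X] x, IsClosed t ∧ ∀ A g, IsClosed A → IsSmoothExtensionNear I X f A g →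
      ∃ g', IsSmoothExtensionNear I X f (A ∪ t) g' ∧ EqOn g' g A := by
  classical
  obtain ⟨g₀, W, hW, hxW, hg₀, hg₀f⟩ := hf
  rw [singleton_subset_iff] at hxW
  set φ := extChartAt I (f x) with hφ
  have htar : φ.target ∈ 𝓝 (φ (f x)) := mem_interior_iff_mem_nhds.1 <|
    ModelWithCorners.isInteriorPoint_iff.1 (BoundarylessManifold.isInteriorPoint (I := I) (x := f x))
  obtain ⟨r, hr, hball⟩ := Metric.mem_nhds_iff.1 htar
  set B := Metric.ball (φ (f x)) r
  have hsrc : IsOpen φ.source := isOpen_extChartAt_source (f x)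
  set S := φ.source ∩ φ ⁻¹' B
  have hS : IsOpen S :=
    (continuousOn_extChartAt (f x)).isOpen_inter_preimage hsrc Metric.isOpen_ball
  have hφs : ContMDiffOn I 𝓘(ℝ, E) ∞ φ φ.source := by
    rw [hφ, extChartAt_source]; exact contMDiffOn_extChartAt
  have hφt : ContMDiffOn 𝓘(ℝ, E) I ∞ φ.symm B := (contMDiffOn_extChartAt_symm (f x)).mono hball
  have hxS : f x ∈ S := ⟨mem_extChartAt_source (f x), Metric.mem_ball_self hr⟩
  have hW₀ : IsOpen (W ∩ g₀ ⁻¹' S) := hg₀.continuousOn.isOpen_inter_preimage hW hS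
  have hx₀ : x ∈ W ∩ g₀ ⁻¹' S := ⟨hxW, by rw [mem_preimage, hg₀f ⟨hxW, hx⟩]; exact hxS⟩
  obtain ⟨L, hL, hLc, hLW⟩ := exists_mem_nhds_isClosed_subset (hW₀.mem_nhds hx₀)
  refine ⟨X ∩ L, inter_mem_nhdsWithin X hL, hX.inter hLc, ?_⟩
  rintro A g hA ⟨O, hO, hAO, hg, hgf⟩
  obtain ⟨ρ, hρ, hρ1, hρO, hρ01⟩ := exists_smooth_cutoff hA hO hAO
  obtain ⟨O₁, hO₁, hAO₁, hρO₁⟩ := eventually_nhdsSet_iff_exists.1 hρ1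
  have hO₁O : O₁ ⊆ O := fun y hy ↦ hρO (subset_tsupport ρ (by simp [hρO₁ y hy]))
  set N := (W ∩ g₀ ⁻¹' S) ∩ ((O ∩ g ⁻¹' S) ∪ (tsupport ρ)ᶜ)
  have hN : IsOpen N := hW₀.inter
    ((hg.continuousOn.isOpen_inter_preimage hO hS).union (isClosed_tsupport ρ).isOpen_compl)
  set c : V → E := fun y ↦ φ (g₀ y) + ρ y • (φ (g y) - φ (g₀ y))
  have hcB : MapsTo c N B := by
    rintro y ⟨⟨-, hy₀⟩, hy | hy⟩
    · have := (convex_ball (φ (f x)) r).add_smul_sub_mem hy₀.2 hy.2.2 (hρ01 y)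
      exact this
    · simp only [c, image_eq_zero_of_notMem_tsupport hy, zero_smul, add_zero]
      exact hy₀.2
  have hc₀ : ∀ y ∈ W ∩ g₀ ⁻¹' S, ContDiffAt ℝ ∞ (fun y ↦ φ (g₀ y)) y := fun y hy ↦ by
    refine ContMDiffAt.contDiffAt ?_
    exact (hφs.contMDiffAt (hsrc.mem_nhds hy.2.1)).comp y (hg₀.contMDiffAt (hW.mem_nhds hy.1))
  have hc : ContMDiffOn 𝓘(ℝ, V) 𝓘(ℝ, E) ∞ c N := by
    rintro y ⟨hy₀, hy | hy⟩
    · have h1 : ContDiffAt ℝ ∞ (fun y ↦ φ (g y)) y := ContMDiffAt.contDiffAt <|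
        (hφs.contMDiffAt (hsrc.mem_nhds hy.2.1)).comp y (hg.contMDiffAt (hO.mem_nhds hy.1))
      exact ((hc₀ y hy₀).add
        (hρ.contDiffAt.smul (h1.sub (hc₀ y hy₀)))).contMDiffAt.contMDiffWithinAt
    · refine ContMDiffAt.contMDiffWithinAt (ContDiffAt.contMDiffAt ?_)
      refine (hc₀ y hy₀).congr_of_eventuallyEq ?_
      filter_upwards [(isClosed_tsupport ρ).isOpen_compl.mem_nhds hy] with z hz
      simp [c, image_eq_zero_of_notMem_tsupport hz]
  set g' : V → M := fun y ↦ if y ∈ N then φ.symm (c y) else g y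
  have hg'N : EqOn g' (φ.symm ∘ c) N := fun y hy ↦ if_pos hy
  have hg'O₁ : EqOn g' g O₁ := by
    intro y hy
    by_cases hyN : y ∈ N
    · have hyS : g y ∈ S := by
        rcases hyN.2 with h | h
        · exact h.2
        · exact absurd (subset_tsupport ρ (by simp [hρO₁ y hy])) h
      rw [hg'N hyN]
      simp only [Function.comp_apply, c, hρO₁ y hy, one_smul, add_sub_cancel]
      exact φ.left_inv hyS.1
    · exact if_neg hyN
  refine ⟨g', ⟨O₁ ∪ N, hO₁.union hN, union_subset_union hAO₁ ?_, ?_, ?_⟩, hg'O₁.mono hAO₁⟩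
  · rintro y ⟨hyX, hy'⟩
    have hyL := hLW hy'
    refine ⟨hyL, ?_⟩
    by_cases hy : y ∈ tsupport ρ
    · refine Or.inl ⟨hρO hy, ?_⟩
      have := hyL.2
      rwa [mem_preimage, hg₀f ⟨hyL.1, hyX⟩, ← hgf ⟨hρO hy, hyX⟩] at this
    · exact Or.inr hy
  · refine ContMDiffOn.union_of_isOpen ?_ ?_ hO₁ hN
    · exact (hg.mono hO₁O).congr hg'O₁
    · exact (hφt.comp hc hcB).congr hg'N
  · rintro y ⟨hy | hyN, hyX⟩
    · rw [hg'O₁ hy, hgf ⟨hO₁O hy, hyX⟩]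
    · have h0 : g₀ y = f y := hg₀f ⟨hyN.1.1, hyX⟩
      have hcy : c y = φ (f y) := by
        rcases hyN.2 with h | h
        · simp [c, h0, hgf ⟨h.1, hyX⟩]
        · simp [c, h0, image_eq_zero_of_notMem_tsupport h]
      rw [hg'N hyN, Function.comp_apply, hcy]
      refine φ.left_inv ?_
      rw [← h0]
      exact hyN.1.2.1

end SmoothExtension

section SmoothExtension

open Set Topology Filter

variable {V : Type*} [NormedAddCommGroup V] [NormedSpace ℝ V]
  {E : Type*} [NormedAddCommGroup E] [NormedSpace ℝ E]
  {H : Type*} [TopologicalSpace H] {I : ModelWithCorners ℝ E H}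
  {M : Type*} [TopologicalSpace M] [ChartedSpace H M]

lemma IsSmoothExtensionNear.mono {X : Set V} {f : V → M} {A B : Set V} {g : V → M}
    (h : IsSmoothExtensionNear I X f B g) (hAB : A ⊆ B) : IsSmoothExtensionNear I X f A g :=
  let ⟨O, hO, hBO, h'⟩ := h
  ⟨O, hO, hAB.trans hBO, h'⟩

/-- The compact step: an extension near a closed set can be modified away from that set so that it
becomes an extension near a given compact subset of `X` as well. -/
lemma IsCompact.exists_isSmoothExtensionNear_union [FiniteDimensional ℝ V] [IsManifold I ∞ M]
    [BoundarylessManifold I M] {X : Set V} (hX : IsClosed X) {f : V → M}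
    (hf : ∀ x ∈ X, ∃ g, IsSmoothExtensionNear I X f {x} g)
    {K : Set V} (hK : IsCompact K) (hKX : K ⊆ X) {A : Set V} {g : V → M} (hA : IsClosed A)
    (hg : IsSmoothExtensionNear I X f A g) :
    ∃ g', IsSmoothExtensionNear I X f (A ∪ K) g' ∧ EqOn g' g A := by
  suffices ∃ T, K ⊆ T ∧ IsClosed T ∧ ∀ A g, IsClosed A → IsSmoothExtensionNear I X f A g →
      ∃ g', IsSmoothExtensionNear I X f (A ∪ T) g' ∧ EqOn g' g A by
    obtain ⟨T, hKT, -, hT⟩ := this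
    obtain ⟨g', hg', h⟩ := hT A g hA hg
    exact ⟨g', hg'.mono (union_subset_union_right A hKT), h⟩
  refine hK.induction_on (p := fun K ↦ ∃ T, K ⊆ T ∧ IsClosed T ∧ ∀ A g, IsClosed A →
    IsSmoothExtensionNear I X f A g →
      ∃ g', IsSmoothExtensionNear I X f (A ∪ T) g' ∧ EqOn g' g A) ?_ ?_ ?_ ?_
  · exact ⟨∅, subset_rfl, isClosed_empty, fun A g _ hg ↦
      ⟨g, by rwa [union_empty], eqOn_refl g A⟩⟩
  · rintro s t hst ⟨T, hT, h⟩
    exact ⟨T, hst.trans hT, h⟩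
  · rintro s t ⟨T, hsT, hT, h⟩ ⟨T', htT', hT', h'⟩
    refine ⟨T ∪ T', union_subset_union hsT htT', hT.union hT', fun A g hA hg ↦ ?_⟩
    obtain ⟨g₁, hg₁, h₁⟩ := h A g hA hg
    obtain ⟨g₂, hg₂, h₂⟩ := h' _ g₁ (hA.union hT) hg₁
    exact ⟨g₂, by rwa [← union_assoc], (h₂.mono subset_union_left).trans h₁⟩
  · intro x hx
    obtain ⟨t, ht, h⟩ := exists_isSmoothExtensionNear_union_nhds hX (hKX hx) (hf x (hKX hx))
    exact ⟨t, nhdsWithin_mono x hKX ht, t, subset_rfl, h⟩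

/-- A map from a closed subset `X` of a finite-dimensional vector space to a manifold without
boundary that extends smoothly near each point of `X` extends smoothly to a neighbourhood of `X`. -/
theorem exists_isSmoothExtensionNear [FiniteDimensional ℝ V] [IsManifold I ∞ M]
    [BoundarylessManifold I M] {X : Set V} (hX : IsClosed X) {f : V → M}
    (hf : ∀ x ∈ X, ∃ g, IsSmoothExtensionNear I X f {x} g) :
    ∃ g, IsSmoothExtensionNear I X f X g := by
  classical
  have step : ∀ (n : ℕ) (p : Set V × (V → M)),
      IsClosed p.1 ∧ IsSmoothExtensionNear I X f p.1 p.2 →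
      ∃ q : Set V × (V → M), (IsClosed q.1 ∧ IsSmoothExtensionNear I X f q.1 q.2) ∧
        p.1 ⊆ q.1 ∧ X ∩ Metric.closedBall 0 n ⊆ interior q.1 ∧ EqOn q.2 p.2 p.1 := by
    rintro n ⟨A, g⟩ ⟨hA, hg⟩
    have hK : IsCompact (X ∩ Metric.closedBall (0 : V) n) :=
      (isCompact_closedBall 0 _).inter_left hX
    obtain ⟨g', ⟨O, hO, hAO, h⟩, hg'⟩ :=
      hK.exists_isSmoothExtensionNear_union hX hf inter_subset_left hA hg
    obtain ⟨L, hL, hKL, hLO⟩ := exists_compact_between hK hO (subset_union_right.trans hAO)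
    exact ⟨(A ∪ L, g'), ⟨hA.union hL.isClosed,
      O, hO, union_subset (subset_union_left.trans hAO) hLO, h⟩, subset_union_left,
      hKL.trans (interior_mono subset_union_right), hg'⟩
  choose! next hnext using step
  let s : ℕ → Set V × (V → M) := fun n ↦ n.rec (∅, f) next
  have hs : ∀ n, IsClosed (s n).1 ∧ IsSmoothExtensionNear I X f (s n).1 (s n).2 := fun n ↦ by
    induction n with
    | zero =>
      exact ⟨isClosed_empty, ∅, isOpen_empty, subset_rfl, by simp [ContMDiffOn], by simp⟩
    | succ n ih => exact (hnext n (s n) ih).1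
  have hmono : Monotone fun n ↦ (s n).1 :=
    monotone_nat_of_le_succ fun n ↦ (hnext n (s n) (hs n)).2.1
  have heq : ∀ m n, m ≤ n → EqOn (s n).2 (s m).2 (s m).1 := fun m n hmn ↦ by
    induction n, hmn using Nat.le_induction with
    | base => exact eqOn_refl _ _
    | succ n hmn ih =>
      exact ((hnext n (s n) (hs n)).2.2.2.mono (hmono hmn)).trans ih
  let g : V → M := fun x ↦ if h : ∃ n, x ∈ (s n).1 then (s (Nat.find h)).2 x else f x
  have hg : ∀ n, EqOn g (s n).2 (s n).1 := fun n x hx ↦ by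
    have h : ∃ n, x ∈ (s n).1 := ⟨n, hx⟩
    simp only [g, dif_pos h]
    exact (heq _ n (Nat.find_min' h hx) (Nat.find_spec h)).symm
  refine ⟨g, ⋃ n, interior (s n).1, isOpen_iUnion fun n ↦ isOpen_interior, fun x hx ↦ ?_, ?_, ?_⟩
  · obtain ⟨n, hn⟩ := exists_nat_ge ‖x‖
    exact mem_iUnion.2 ⟨n + 1, (hnext n (s n) (hs n)).2.2.1 ⟨hx, by simpa using hn⟩⟩
  · intro x hx
    obtain ⟨n, hn⟩ := mem_iUnion.1 hx
    obtain ⟨O, hO, hAO, h, -⟩ := (hs n).2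
    refine ContMDiffAt.contMDiffWithinAt ?_
    refine (h.contMDiffAt (hO.mem_nhds (hAO (interior_subset hn)))).congr_of_eventuallyEq ?_
    filter_upwards [isOpen_interior.mem_nhds hn] with y hy using hg n (interior_subset hy)
  · rintro x ⟨hx, hxX⟩
    obtain ⟨n, hn⟩ := mem_iUnion.1 hx
    obtain ⟨O, hO, hAO, -, h⟩ := (hs n).2
    rw [hg n (interior_subset hn), h ⟨hAO (interior_subset hn), hxX⟩]

/-- If the closed set `X` is a cone, then the extension can be chosen to be smooth everywhere. -/
theorem exists_contMDiff_eqOn_of_cone [FiniteDimensional ℝ V] [IsManifold I ∞ M]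
    [BoundarylessManifold I M] {X : Set V} (hX : IsClosed X) (h0 : (0 : V) ∈ X)
    (hcone : ∀ (a : ℝ), ∀ x ∈ X, a • x ∈ X) {f : V → M}
    (hf : ∀ x ∈ X, ∃ g, IsSmoothExtensionNear I X f {x} g) :
    ∃ F : V → M, ContMDiff 𝓘(ℝ, V) I ∞ F ∧ EqOn F f X := by
  obtain ⟨g, U, hU, hXU, hg, hgf⟩ := exists_isSmoothExtensionNear hX hf
  set D : Set V := {x | ∀ a ∈ Icc (0 : ℝ) 1, a • x ∈ U}
  have hD : IsOpen D := by
    refine isOpen_iff_mem_nhds.2 fun x hx ↦ ?_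
    refine (isCompact_Icc (a := (0 : ℝ)) (b := 1)).eventually_forall_of_forall_eventually
      (x₀ := x) (P := fun x a ↦ a • x ∈ U) fun a ha ↦ ?_
    exact (continuous_snd.smul continuous_fst).continuousAt.eventually_mem
      (hU.mem_nhds (hx a ha))
  obtain ⟨a, ha, ha1, haD, ha01⟩ := exists_smooth_cutoff hX hD fun x hx b _ ↦ hXU (hcone b x hx)
  have hmaps : ∀ x, a x • x ∈ U := fun x ↦ by
    by_cases hx : x ∈ tsupport a
    · exact haD hx _ (ha01 x)
    · rw [image_eq_zero_of_notMem_tsupport hx, zero_smul]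
      exact hXU h0
  refine ⟨fun x ↦ g (a x • x), ?_, fun x hx ↦ ?_⟩
  · exact hg.comp_contMDiff (ha.smul contDiff_id).contMDiff hmaps
  · simp only [ha1.self_of_nhdsSet x hx, one_smul]
    exact hgf ⟨hXU hx, hx⟩

end SmoothExtension

section Projections

open Set Topology Filter

variable {V : Type*} [NormedAddCommGroup V] [NormedSpace ℝ V]
  {E : Type*} [NormedAddCommGroup E] [NormedSpace ℝ E]
  {ι : Type*} (π : ι → V →L[ℝ] V)

/-- A vector-valued map defined on the union of the fixed spaces of some compatible projections
extends smoothly near a common fixed point if it is smooth on each of these spaces. -/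
lemma exists_contDiffAt_eventually_eq_of_fixed
    (hπ : ∀ i j v, π j v = v → π j (π i v) = π i v) {u : V → E} {x : V} (s : Finset ι)
    (hx : ∀ i ∈ s, π i x = x)
    (hu : ∀ i ∈ s, ∀ᶠ y in 𝓝 x, ContDiffAt ℝ ∞ (fun z ↦ u (π i z)) y) :
    ∃ h : V → E, (∀ᶠ y in 𝓝 x, ContDiffAt ℝ ∞ h y) ∧
      ∀ᶠ y in 𝓝 x, ∀ i ∈ s, π i y = y → h y = u y := by
  classical
  induction s using Finset.induction_on with
  | empty => exact ⟨0, .of_forall fun y ↦ contDiffAt_const, by simp⟩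
  | insert i s his ih =>
    obtain ⟨h, hh, heq⟩ := ih (fun j hj ↦ hx j (Finset.mem_insert_of_mem hj))
      fun j hj ↦ hu j (Finset.mem_insert_of_mem hj)
    have hi : Tendsto (π i) (𝓝 x) (𝓝 x) := by
      simpa [hx i (Finset.mem_insert_self i s)] using (π i).continuous.tendsto x
    refine ⟨fun y ↦ h y + (u (π i y) - h (π i y)), ?_, ?_⟩
    · filter_upwards [hh, hi.eventually hh, hu i (Finset.mem_insert_self i s)] with y h1 h2 h3
      exact h1.add (h3.sub (h2.comp y (π i).contDiff.contDiffAt))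
    · filter_upwards [heq, hi.eventually heq] with y h1 h2 j hj hjy
      rcases Finset.mem_insert.1 hj with rfl | hj
      · simp [hjy]
      · rw [h1 j hj hjy, h2 j hj (hπ i j y hjy), sub_self, add_zero]

variable {H : Type*} [TopologicalSpace H] {I : ModelWithCorners ℝ E H}
  {M : Type*} [TopologicalSpace M] [ChartedSpace H M] [IsManifold I ∞ M] [BoundarylessManifold I M]

/-- A map to a manifold that is smooth on the fixed space of each of finitely many compatible
projections extends smoothly from the union of these spaces. -/
theorem exists_contMDiff_eq_of_fixed [FiniteDimensional ℝ V] [Finite ι] [Nonempty ι]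
    (hπ : ∀ i j v, π j v = v → π j (π i v) = π i v) {f : V → M}
    (hf : ∀ i, ContMDiff 𝓘(ℝ, V) I ∞ fun v ↦ f (π i v)) :
    ∃ F : V → M, ContMDiff 𝓘(ℝ, V) I ∞ F ∧ ∀ i v, π i v = v → F v = f v := by
  classical
  have := Fintype.ofFinite ι
  have hclosed : ∀ i, IsClosed {v | π i v = v} := fun i ↦
    isClosed_eq (π i).continuous continuous_id
  set X : Set V := ⋃ i, {v | π i v = v}
  have hX : IsClosed X := isClosed_iUnion_of_finite hclosed
  suffices ∀ x ∈ X, ∃ g, IsSmoothExtensionNear I X f {x} g by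
    have hcone : ∀ (a : ℝ), ∀ x ∈ X, a • x ∈ X := fun a x hx ↦ by
      obtain ⟨i, hi⟩ := mem_iUnion.1 hx
      exact mem_iUnion.2 ⟨i, by rw [mem_ofPred_eq, map_smul, hi]⟩
    obtain ⟨F, hF, h⟩ := exists_contMDiff_eqOn_of_cone hX
      (mem_iUnion.2 ⟨Classical.arbitrary ι, map_zero _⟩) hcone this
    exact ⟨F, hF, fun i v hv ↦ h (mem_iUnion.2 ⟨i, hv⟩)⟩
  intro x hxX
  set φ := extChartAt I (f x)
  set s : Finset ι := {i | π i x = x}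
  have hfix : ∀ i ∈ s, π i x = x := fun i hi ↦ (Finset.mem_filter.1 hi).2
  have hsX : ∀ᶠ y in 𝓝 x, ∀ i, π i y = y → i ∈ s := by
    refine eventually_all.2 fun i ↦ ?_
    by_cases hi : π i x = x
    · exact .of_forall fun _ _ ↦ Finset.mem_filter.2 ⟨Finset.mem_univ i, hi⟩
    · filter_upwards [(hclosed i).isOpen_compl.mem_nhds hi] with y hy h using absurd h hy
  have hsrc : ∀ i ∈ s, ∀ᶠ y in 𝓝 x, f (π i y) ∈ φ.source := fun i hi ↦
    (hf i).continuous.continuousAt.eventually_mem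
      (by rw [hfix i hi]; exact extChartAt_source_mem_nhds (f x))
  obtain ⟨h, hh, heq⟩ := exists_contDiffAt_eventually_eq_of_fixed π hπ (u := fun y ↦ φ (f y)) s
    hfix fun i hi ↦ by
      filter_upwards [hsrc i hi] with y hy
      refine ContMDiffAt.contDiffAt ?_
      exact (contMDiffAt_extChartAt' (by rwa [extChartAt_source] at hy)).comp y (hf i y)
  have hhx : h x = φ (f x) := by
    obtain ⟨i, hi⟩ := mem_iUnion.1 hxX
    exact heq.self_of_nhds i (hsX.self_of_nhds i hi) hi
  have htar : interior φ.target ∈ 𝓝 (h x) := hhx ▸ isOpen_interior.mem_nhds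
    (ModelWithCorners.isInteriorPoint_iff.1 (BoundarylessManifold.isInteriorPoint (I := I)))
  have hint : ∀ᶠ y in 𝓝 x, h y ∈ interior φ.target :=
    hh.self_of_nhds.continuousAt.eventually_mem htar
  have hsrc' : ∀ᶠ y in 𝓝 x, ∀ i ∈ s, f (π i y) ∈ φ.source := (Finset.eventually_all s).2 hsrc
  obtain ⟨O, hO, hOo, hxO⟩ :=
    eventually_nhds_iff.1 (hh.and (hint.and (heq.and (hsX.and hsrc'))))
  refine ⟨fun y ↦ φ.symm (h y), O, hOo, singleton_subset_iff.2 hxO, fun y hy ↦ ?_, ?_⟩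
  · have h1 : ContMDiffAt 𝓘(ℝ, E) I ∞ φ.symm (h y) :=
      (contMDiffOn_extChartAt_symm (f x)).contMDiffAt (mem_interior_iff_mem_nhds.1 (hO y hy).2.1)
    exact (h1.comp y (hO y hy).1.contMDiffAt).contMDiffWithinAt
  · rintro y ⟨hy, hyX⟩
    obtain ⟨i, hi⟩ := mem_iUnion.1 hyX
    obtain ⟨-, -, h3, h4, h5⟩ := hO y hy
    have his := h4 i hi
    have := h5 i his
    rw [hi] at this
    simp only [h3 i his hi]
    exact φ.left_inv this

end Projections

section HornFilling

open Simplicial Opposite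

/-- The vertices of a simplex can be moved monotonically out of a set `T` of vertices, while the
vertices outside `T` stay fixed. -/
lemma SimplexCategory.exists_hom_notMem {n : ℕ} (T : Finset (Fin (n + 1))) {k : Fin (n + 1)}
    (hk : k ∉ T) : ∃ w : ⦋n⦌ ⟶ ⦋n⦌, (∀ a, w a ∉ T) ∧ ∀ a ∉ T, w a = a := by
  classical
  have hup : ∀ a, a ≤ k → (Tᶜ.filter (a ≤ ·)).Nonempty := fun a ha ↦ ⟨k, by simp [hk, ha]⟩
  have hdown : ∀ a, ¬a ≤ k → (Tᶜ.filter (· ≤ a)).Nonempty := fun a ha ↦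
    ⟨k, by simp [hk, (not_le.1 ha).le]⟩
  let w : Fin (n + 1) → Fin (n + 1) := fun a ↦
    if h : a ≤ k then (Tᶜ.filter (a ≤ ·)).min' (hup a h) else (Tᶜ.filter (· ≤ a)).max' (hdown a h)
  have hw : Monotone w := by
    intro a b hab
    by_cases hb : b ≤ k
    · simp only [w, dif_pos hb, dif_pos (hab.trans hb)]
      exact Finset.min'_subset _ fun c hc ↦ by
        simp only [Finset.mem_filter] at hc ⊢; exact ⟨hc.1, hab.trans hc.2⟩
    · by_cases ha : a ≤ k
      · simp only [w, dif_pos ha, dif_neg hb]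
        exact (Finset.min'_le _ k (by simp [hk, ha])).trans
          (Finset.le_max' _ k (by simp [hk, (not_le.1 hb).le]))
      · simp only [w, dif_neg ha, dif_neg hb]
        exact Finset.max'_subset _ fun c hc ↦ by
          simp only [Finset.mem_filter] at hc ⊢; exact ⟨hc.1, hc.2.trans hab⟩
  refine ⟨SimplexCategory.Hom.mk ⟨w, hw⟩, fun a ↦ ?_, fun a ha ↦ ?_⟩
  · change w a ∉ T
    by_cases h : a ≤ k
    · simp only [w, dif_pos h]
      have := Finset.min'_mem _ (hup a h)
      simp only [Finset.mem_filter, Finset.mem_compl] at this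
      exact this.1
    · simp only [w, dif_neg h]
      have := Finset.max'_mem _ (hdown a h)
      simp only [Finset.mem_filter, Finset.mem_compl] at this
      exact this.1
  · change w a = a
    by_cases h : a ≤ k
    · simp only [w, dif_pos h]
      refine le_antisymm (Finset.min'_le _ a (by simp [ha])) (Finset.le_min' _ _ _ fun c hc ↦ ?_)
      exact (Finset.mem_filter.1 hc).2
    · simp only [w, dif_neg h]
      refine le_antisymm (Finset.max'_le _ _ _ fun c hc ↦ ?_) (Finset.le_max' _ a (by simp [ha]))
      exact (Finset.mem_filter.1 hc).2

namespace AffineSimplex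

/-- A map of simplices that fixes every vertex with a nonzero coordinate fixes the point. -/
lemma map_eq_self {n : SimplexCategory} (w : n ⟶ n) (x : AffineSimplex n)
    (h : ∀ a, w a ≠ a → x.1 a = 0) : map w x = x := by
  apply Subtype.ext
  ext j
  rw [map_apply]
  have : ∀ i, (if w i = j then x.1 i else 0) = if i = j then x.1 i else 0 := fun i ↦ by
    by_cases hi : w i = i
    · rw [hi]
    · simp [h i hi]
  simp [this]

lemma map_apply_eq_zero {n m : SimplexCategory} (f : n ⟶ m) (x : AffineSimplex n)
    {j : Fin (m.len + 1)} (h : ∀ i, f i ≠ j) : (map f x).1 j = 0 := by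
  simp [map_apply, h]

/-- The retraction of `ℝⁿ⁺¹` onto `𝔸ⁿ` along the `k`-th coordinate axis. -/
noncomputable def retraction {n : SimplexCategory} (k : Fin (n.len + 1))
    (v : EuclideanSpace ℝ (Fin (n.len + 1))) : AffineSimplex n :=
  ⟨v + (1 - ∑ i, v i) • EuclideanSpace.single k 1, by
    simp [Finset.sum_add_distrib]⟩

lemma retraction_apply {n : SimplexCategory} {k i : Fin (n.len + 1)} (hi : i ≠ k)
    (v : EuclideanSpace ℝ (Fin (n.len + 1))) : (retraction k v).1 i = v i := by
  simp [retraction, hi]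

lemma retraction_coe {n : SimplexCategory} (k : Fin (n.len + 1)) (x : AffineSimplex n) :
    retraction k x.1 = x := by
  apply Subtype.ext
  simp [retraction, x.2]

lemma isPlot_retraction {n : SimplexCategory} (k : Fin (n.len + 1)) :
    IsPlot (retraction (n := n) k) := by
  change ContDiff ℝ ∞ fun v : EuclideanSpace ℝ (Fin (n.len + 1)) ↦
    v + (1 - ∑ i, v i) • EuclideanSpace.single k (1 : ℝ)
  fun_prop

end AffineSimplex

/-- The projection of `ℝⁿ` to the hyperplane on which the `i`-th coordinate vanishes. -/
noncomputable def EuclideanSpace.eraseCoord {ι : Type*} [Fintype ι] [DecidableEq ι] (i : ι) :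
    EuclideanSpace ℝ ι →L[ℝ] EuclideanSpace ℝ ι :=
  .id ℝ _ - (EuclideanSpace.proj i : EuclideanSpace ℝ ι →L[ℝ] ℝ).smulRight
    (EuclideanSpace.single i (1 : ℝ))

lemma EuclideanSpace.eraseCoord_apply {ι : Type*} [Fintype ι] [DecidableEq ι] (i j : ι)
    (v : EuclideanSpace ℝ ι) :
    EuclideanSpace.eraseCoord i v j = if j = i then 0 else v j := by
  by_cases h : j = i
  · subst h; simp [eraseCoord]
  · simp [eraseCoord, h]

lemma EuclideanSpace.eraseCoord_eq_self_iff {ι : Type*} [Fintype ι] [DecidableEq ι] {i : ι}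
    {v : EuclideanSpace ℝ ι} : EuclideanSpace.eraseCoord i v = v ↔ v i = 0 := by
  refine ⟨fun h ↦ ?_, fun h ↦ ?_⟩
  · rw [← h, eraseCoord_apply, if_pos rfl]
  · ext j
    rw [eraseCoord_apply]
    split_ifs with hj
    · rw [hj, h]
    · rfl

open SSet.modelCategoryQuillen in
/-- A simplicial set with fillers for all horns is a Kan complex. -/
lemma SSet.kanComplex_of_forall_horn_extension {S : SSet.{u}}
    (hS : ∀ (n : ℕ) (k : Fin (n + 2)) (t : (Λ[n + 1, k] : SSet.{u}) ⟶ S),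
      ∃ φ : Δ[n + 1] ⟶ S, Λ[n + 1, k].ι ≫ φ = t) : SSet.KanComplex S := by
  refine (HomotopicalAlgebra.isFibrant_iff _).2 ⟨?_⟩
  rw [fibrations_eq]
  intro _ _ _ hi
  simp only [J, MorphismProperty.iSup_iff] at hi
  obtain ⟨n, ⟨k⟩⟩ := hi
  refine ⟨fun {t _} _ ↦ ?_⟩
  obtain ⟨φ, hφ⟩ := hS n k t
  exact ⟨⟨⟨φ, hφ, by subsingleton⟩⟩⟩

open EuclideanSpace in
/-- The smooth singular simplicial set of `X` is a Kan complex if every map to `X` that is smooth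
on all but one of the coordinate hyperplanes of `ℝⁿ⁺²` extends smoothly from their union. -/
theorem kanComplex_smoothSing_of_extension {X : Type u} [DiffeologicalSpace X]
    (hX : ∀ (n : ℕ) (k : Fin (n + 2)) (f : EuclideanSpace ℝ (Fin (n + 2)) → X),
      (∀ i ≠ k, IsPlot fun v ↦ f (eraseCoord i v)) →
      ∃ F : EuclideanSpace ℝ (Fin (n + 2)) → X, IsPlot F ∧ ∀ i ≠ k, ∀ v, v i = 0 → F v = f v) :
    SSet.KanComplex (smoothSing X) := by
  classical
  refine SSet.kanComplex_of_forall_horn_extension fun n k t ↦ ?_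
  have hmem : ∀ {m : SimplexCategory} (w : m ⟶ ⦋n + 1⦌), (∃ i ≠ k, ∀ a, w a ≠ i) →
      SSet.stdSimplex.objEquiv.symm w ∈ (SSet.horn.{u} (n + 1) k).obj (op m) := by
    rintro m w ⟨i, hik, hi⟩
    rw [SSet.mem_horn_iff]
    intro h
    rcases h.ge (Set.mem_univ i) with ⟨a, ha⟩ | h
    · exact hi a ha
    · exact hik h
  let σ {m : SimplexCategory} (w : m ⟶ ⦋n + 1⦌) (hw : ∃ i ≠ k, ∀ a, w a ≠ i) :
      {σ : AffineSimplex m → X // DSmooth σ} :=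
    t.app (op m) ⟨SSet.stdSimplex.objEquiv.symm w, hmem w hw⟩
  have hσ : ∀ {m m' : SimplexCategory} (g : m' ⟶ m) (w : m ⟶ ⦋n + 1⦌) (w' : m' ⟶ ⦋n + 1⦌)
      (_ : g ≫ w = w') (hw : ∃ i ≠ k, ∀ a, w a ≠ i) (hw' : ∃ i ≠ k, ∀ a, w' a ≠ i)
      (x : AffineSimplex m'), (σ w' hw').1 x = (σ w hw).1 (AffineSimplex.map g x) := by
    rintro m m' g w _ rfl hw hw' x
    have := ConcreteCategory.congr_hom (t.naturality g.op)
      ⟨SSet.stdSimplex.objEquiv.symm w, hmem w hw⟩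
    exact congrFun (congrArg Subtype.val this) x
  have hindep : ∀ (i j : Fin (n + 2)), i ≠ k → j ≠ k → ∀ (w w' : ⦋n + 1⦌ ⟶ ⦋n + 1⦌) hw hw',
      (∀ a ∉ ({i} : Finset _), w a = a) → (∀ a ∉ ({j} : Finset _), w' a = a) →
      ∀ x : AffineSimplex ⦋n + 1⦌, x.1 i = 0 → x.1 j = 0 → (σ w hw).1 x = (σ w' hw').1 x := by
    intro i j hi hj w w' hw hw' hwi hwj x hxi hxj
    obtain ⟨c, hc, hc'⟩ := SimplexCategory.exists_hom_notMem {i, j} (k := k)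
      (by simp [hi.symm, hj.symm])
    have hcx : AffineSimplex.map c x = x := AffineSimplex.map_eq_self c x fun a ha ↦ by
      have : a ∈ ({i, j} : Finset (Fin (n + 2))) := by
        by_contra h
        exact ha (hc' a h)
      rcases Finset.mem_insert.1 this with rfl | h
      · exact hxi
      · rw [Finset.mem_singleton.1 h, hxj]
    have hcw : c ≫ w = c := by
      ext a : 3
      exact hwi (c a) fun h ↦ hc a (Finset.mem_insert.2 (Or.inl (Finset.mem_singleton.1 h)))
    have hcw' : c ≫ w' = c := by
      ext a : 3
      exact hwj (c a) fun h ↦ hc a (Finset.mem_insert_of_mem h)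
    have hcav : ∃ i ≠ k, ∀ a, c a ≠ i := ⟨i, hi, fun a h ↦ hc a (by simp [h])⟩
    have h := hσ c w c hcw hw hcav x
    rw [hσ c w' c hcw' hw' hcav x, hcx] at h
    exact h.symm
  have he : ∀ i : {i // i ≠ k}, ∃ w : ⦋n + 1⦌ ⟶ ⦋n + 1⦌, (∀ a, w a ∉ ({i.1} : Finset _)) ∧
      ∀ a ∉ ({i.1} : Finset _), w a = a := fun i ↦
    SimplexCategory.exists_hom_notMem {i.1} (by simpa using i.2.symm)
  choose e he he' using he
  have hav : ∀ i : {i // i ≠ k}, ∃ j ≠ k, ∀ a, e i a ≠ j := fun i ↦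
    ⟨i, i.2, fun a h ↦ he i a (by simp [h])⟩
  obtain ⟨i₀, hi₀⟩ := exists_ne k
  let face : EuclideanSpace ℝ (Fin (n + 2)) → {i // i ≠ k} := fun v ↦
    if h : ∃ i, i ≠ k ∧ v i = 0 then ⟨h.choose, h.choose_spec.1⟩ else ⟨i₀, hi₀⟩
  let f : EuclideanSpace ℝ (Fin (n + 2)) → X := fun v ↦
    (σ (e (face v)) (hav _)).1 (AffineSimplex.retraction k v)
  have hf : ∀ i : {i // i ≠ k}, ∀ v : EuclideanSpace ℝ (Fin (n + 2)), v i = 0 →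
      f v = (σ (e i) (hav i)).1 (AffineSimplex.retraction k v) := by
    intro i v hv
    have h : ∃ i, i ≠ k ∧ v i = 0 := ⟨i, i.2, hv⟩
    have hface : v (face v) = 0 := by
      simp only [face, dif_pos h]
      exact h.choose_spec.2
    refine hindep _ _ (face v).2 i.2 _ _ (hav _) (hav _) (he' _) (he' _) _ ?_ ?_
    · rw [AffineSimplex.retraction_apply (face v).2, hface]
    · rw [AffineSimplex.retraction_apply i.2, hv]
  obtain ⟨F, hF, hFf⟩ := hX n k f fun i hi ↦ by
    have h : (fun v ↦ f (eraseCoord i v)) = (σ (e ⟨i, hi⟩) (hav _)).1 ∘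
        (AffineSimplex.retraction (n := ⦋n + 1⦌) k ∘ eraseCoord i) := by
      funext v
      exact hf ⟨i, hi⟩ _ (by simp [eraseCoord_apply])
    rw [h]
    exact (σ (e ⟨i, hi⟩) (hav _)).2 _ _
      (isPlot_reparam (AffineSimplex.isPlot_retraction k) (eraseCoord i).contDiff)
  refine ⟨SSet.yonedaEquiv.symm ⟨fun x ↦ F x.1, fun m p hp ↦ isPlot_reparam hF hp⟩, ?_⟩
  ext m s
  obtain ⟨s, hs⟩ := s
  obtain ⟨w, rfl⟩ := SSet.stdSimplex.objEquiv.symm.surjective s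
  have hw : ∃ i ≠ k, ∀ a, w a ≠ i := by
    rw [SSet.mem_horn_iff, Ne, Set.eq_univ_iff_forall, not_forall] at hs
    obtain ⟨i, hi⟩ := hs
    exact ⟨i, fun h ↦ hi (Or.inr h), fun a h ↦ hi (Or.inl ⟨a, h⟩)⟩
  obtain ⟨i, hik, hi⟩ := id hw
  refine Subtype.ext (funext fun x ↦ ?_)
  change F (AffineSimplex.map w x).1 = (σ w hw).1 x
  have hwe : w ≫ e ⟨i, hik⟩ = w := by
    ext a : 3
    exact he' ⟨i, hik⟩ (w a) (by simpa using hi a)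
  have h0 := AffineSimplex.map_apply_eq_zero w x hi
  calc F (AffineSimplex.map w x).1 = f (AffineSimplex.map w x).1 := hFf i hik _ h0
    _ = (σ (e ⟨i, hik⟩) (hav _)).1 (AffineSimplex.retraction k (AffineSimplex.map w x).1) :=
      hf ⟨i, hik⟩ _ h0
    _ = (σ (e ⟨i, hik⟩) (hav _)).1 (AffineSimplex.map w x) := by
      rw [AffineSimplex.retraction_coe]
    _ = (σ w hw).1 x := (hσ w _ w hwe (hav _) hw x).symm

end HornFilling

theorem mainTheorem4 {E : Type*} [NormedAddCommGroup E] [NormedSpace ℝ E] [FiniteDimensional ℝ E]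
    {H : Type*} [TopologicalSpace H] (I : ModelWithCorners ℝ E H)
    (M : Type*) [TopologicalSpace M] [ChartedSpace H M] [IsManifold I ∞ M]
    [BoundarylessManifold I M] [T2Space M] [SecondCountableTopology M] :
    (I.diffeology M).IsFibrant := by
  let := I.diffeology M
  refine kanComplex_smoothSing_of_extension fun n k f hf ↦ ?_
  have : Nonempty {i // i ≠ k} := let ⟨i, hi⟩ := exists_ne k; ⟨⟨i, hi⟩⟩
  have hπ : ∀ (i j : {i // i ≠ k}) (v : EuclideanSpace ℝ (Fin (n + 2))),
      EuclideanSpace.eraseCoord j.1 v = v → EuclideanSpace.eraseCoord j.1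
        (EuclideanSpace.eraseCoord i.1 v) = EuclideanSpace.eraseCoord i.1 v := fun i j v hv ↦ by
    rw [EuclideanSpace.eraseCoord_eq_self_iff] at hv ⊢
    rw [EuclideanSpace.eraseCoord_apply, hv, ite_self]
  obtain ⟨F, hF, h⟩ := exists_contMDiff_eq_of_fixed (I := I) _ hπ (f := f) fun i ↦ hf i i.2
  exact ⟨F, hF, fun i hi v hv ↦ h ⟨i, hi⟩ v (EuclideanSpace.eraseCoord_eq_self_iff.2 hv)⟩
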